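/- Theorem (Coburn, 1966). Equip the unit circle $\mathbb T$ with the normalized Lebesgue measure $\frac{d\theta}{2\pi}$, and for $f\in L^2(\mathbb T)$ and $n\in\mathbb Z$ let $\hat f(n)=\int_0^{2\pi} f(e^{i\theta})e^{-in\theta}\,\frac{d\theta}{2\pi}$. Let $$H^2=\{f\in L^2(\mathbb T): \hat f(n)=0 \text{ for all } n<0\}$$ be the Hardy space, a closed subspace of $L^2(\mathbb T)$, and let $P_+:L^2(\mathbb T)\to H^2$ be the orthogonal projection onto it. For $\varphi\in L^\infty(\mathbb T)$ (complex-valued), let $T_\varphi:H^2\to H^2$, $T_\varphi f=P_+(\varphi f)$, be the Toeplitz operator with symbol $\varphi$, a bounded operator, and let $T_\varphi^*$ be its Hilbert space adjoint. Let $\varphi\in L^\infty(\mathbb T)$ be nonzero (that is, not almost everywhere equal to $0$). Then $\ker T_\varphi=\{0\}$ or $\ker T_\varphi^*=\{0\}$ (possibly both). -/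

import Mathlib

open MeasureTheory AddCircle
open scoped ENNReal Real

noncomputable section

instance instFactTwoPiPos : Fact (0 < 2 * π) := ⟨Real.two_pi_pos⟩

/-- The unit circle, parametrised by the angle `θ ∈ ℝ / 2πℤ` (the point being `e^{iθ}`). -/
abbrev Torus : Type := AddCircle (2 * π)

/-- Normalised Lebesgue measure `dθ / 2π` on the unit circle. -/
abbrev torusMeasure : Measure Torus := haarAddCircle

/-- The space `L²(𝕋)` of complex functions, for the measure `dθ / 2π`. -/
abbrev L2Torus : Type := Lp ℂ 2 torusMeasure

/-- The space `L^∞(𝕋)` of complex functions, for the measure `dθ / 2π`. -/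
abbrev LinftyTorus : Type := Lp ℂ ∞ torusMeasure

/-- The Hardy space `H² = {f ∈ L²(𝕋) : f̂(n) = 0 for all n < 0}`, where
`f̂(n) = ∫ f(e^{iθ}) e^{-inθ} dθ / 2π`. -/
def hardySpace : Submodule ℂ L2Torus where
  carrier := {f | ∀ n : ℤ, n < 0 → fourierCoeff (f : Torus → ℂ) n = 0}
  zero_mem' := fun n _ => by
    rw [← fourierBasis_repr]; simp
  add_mem' := fun {f g} hf hg n hn => by
    have h1 := hf n hn
    have h2 := hg n hn
    rw [← fourierBasis_repr] at h1 h2 ⊢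
    simp [h1, h2]
  smul_mem' := fun c f hf n hn => by
    have h1 := hf n hn
    rw [← fourierBasis_repr] at h1 ⊢
    simp [h1]

/-- `H²` is closed in `L²(𝕋)`. -/
theorem isClosed_hardySpace : IsClosed (hardySpace : Set L2Torus) := by
  have h : (hardySpace : Set L2Torus) =
      ⋂ n : ℤ, ⋂ _ : n < 0, {f : L2Torus | inner ℂ (fourierBasis n) f = 0} := by
    ext f
    simp only [SetLike.mem_coe, Set.mem_iInter, Set.mem_ofPred_eq,
      ← HilbertBasis.repr_apply_apply, fourierBasis_repr]
    exact Iff.rfl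
  rw [h]
  refine isClosed_iInter fun n => isClosed_iInter fun _ => ?_
  exact isClosed_eq (by fun_prop) continuous_const

instance instCompleteSpaceHardySpace : CompleteSpace hardySpace :=
  isClosed_hardySpace.completeSpace_coe

/-- The orthogonal projection `P₊ : L²(𝕋) → H²`. -/
def rieszProjection : L2Torus →L[ℂ] hardySpace := hardySpace.orthogonalProjectionOnto

/-- Multiplication `f ↦ φ f` on `L²(𝕋)` by a function `φ ∈ L^∞(𝕋)`. -/
def multiplicationOperator (φ : LinftyTorus) : L2Torus →L[ℂ] L2Torus :=
  (ContinuousLinearMap.mul ℂ ℂ).holderL torusMeasure ∞ 2 2 φ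

/-- The Toeplitz operator `T_φ : H² → H²`, `T_φ f = P₊ (φ f)`, with symbol `φ ∈ L^∞(𝕋)`. -/
def toeplitzOperator (φ : LinftyTorus) : hardySpace →L[ℂ] hardySpace :=
  rieszProjection ∘L multiplicationOperator φ ∘L hardySpace.subtypeL

end

open Set Filter Topology ComplexConjugate

namespace Toeplitz

/-! Suppose `f ≠ 0` lies in `ker T_φ` and `g ≠ 0` in `ker T_φ^*`. The integrable function `conj g *
φ * f` has `n`-th Fourier coefficient `⟨e^{inθ} g, T_φ f⟩ = 0` for `n ≥ 0` and `⟨T_φ^* g, e^{-inθ}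
f⟩ = 0` for `n ≤ 0`, so it vanishes a.e. By the F. and M. Riesz theorem `f` and `g` are nonzero
a.e., which forces `φ = 0`. -/

/-- An integrable function on the circle all of whose Fourier coefficients vanish is zero. -/
theorem ae_eq_zero_of_fourierCoeff_eq_zero {F : Torus → ℂ} (hF : Integrable F torusMeasure)
    (h : ∀ n, fourierCoeff F n = 0) : F =ᵐ[torusMeasure] 0 := by
  have hint : ∀ u : C(Torus, ℂ), Integrable (fun t => u t * F t) torusMeasure := fun u =>
    hF.bdd_mul (c := ‖u‖) u.continuous.aestronglyMeasurable (ae_of_all _ u.norm_coe_le_norm)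
  let S : Submodule ℂ C(Torus, ℂ) :=
    { carrier := {u | ∫ t, u t * F t ∂torusMeasure = 0}
      zero_mem' := by simp
      add_mem' := fun {u v} hu hv => by
        simp only [mem_ofPred_eq] at hu hv ⊢
        simp only [ContinuousMap.add_apply, add_mul]
        rw [integral_add (hint u) (hint v), hu, hv, add_zero]
      smul_mem' := fun c u hu => by
        simp only [mem_ofPred_eq] at hu ⊢
        simp only [ContinuousMap.smul_apply, smul_eq_mul, mul_assoc]
        rw [integral_const_mul, hu, mul_zero] }
  have hclosed : IsClosed (S : Set C(Torus, ℂ)) := by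
    have hc : Continuous fun u : C(Torus, ℂ) => ∫ t, u t * F t ∂torusMeasure := by
      refine continuous_iff_continuousAt.2 fun u => ?_
      refine tendsto_integral_filter_of_dominated_convergence (fun t => (‖u‖ + 1) * ‖F t‖)
        (Eventually.of_forall fun v => (hint v).aestronglyMeasurable) ?_
        (hF.norm.const_mul _) (ae_of_all _ fun t => ?_)
      · filter_upwards [continuous_norm.continuousAt.eventually_lt continuousAt_const
          (lt_add_one ‖u‖)] with v hv
        refine ae_of_all _ fun t => ?_
        rw [norm_mul]
        gcongr
        exact (v.norm_coe_le_norm t).trans hv.le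
      · exact ((continuous_eval_const t).tendsto u).mul_const _
    exact isClosed_eq hc continuous_const
  have htop : S = ⊤ := by
    rw [eq_top_iff, ← span_fourier_closure_eq_top]
    refine Submodule.topologicalClosure_minimal _ (Submodule.span_le.2 ?_) hclosed
    rintro _ ⟨n, rfl⟩
    have hn := h (-n)
    rw [fourierCoeff, neg_neg] at hn
    exact hn
  have hzero : ∀ u : C(Torus, ℂ), ∫ t, u t * F t ∂torusMeasure = 0 := fun u => by
    have : u ∈ S := htop ▸ Submodule.mem_top
    exact this
  refine ae_eq_zero_of_forall_setIntegral_isClosed_eq_zero hF fun s hs => ?_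
  rw [← integral_indicator hs.measurableSet]
  -- Continuous functions with values in `[0, 1]` converging pointwise to the indicator of `s`;
  -- `‖F‖` dominates.
  let v : ℕ → C(Torus, ℂ) := fun n => ⟨fun t => ((hs.apprSeq n t : ℝ) : ℂ), by fun_prop⟩
  have hlim : Tendsto (fun n => ∫ t, v n t * F t ∂torusMeasure) atTop
      (𝓝 (∫ t, s.indicator F t ∂torusMeasure)) := by
    refine tendsto_integral_of_dominated_convergence (fun t => ‖F t‖)
      (fun n => (hint (v n)).aestronglyMeasurable) hF.norm
      (fun n => ae_of_all _ fun t => ?_) (ae_of_all _ fun t => ?_)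
    · have h1 : (hs.apprSeq n t : ℝ) ≤ 1 := HasOuterApproxClosed.apprSeq_apply_le_one hs n t
      simp only [v, ContinuousMap.coe_mk, norm_mul, Complex.norm_real, NNReal.norm_eq]
      exact mul_le_of_le_one_left (norm_nonneg _) h1
    · have h1 := tendsto_pi_nhds.1 (HasOuterApproxClosed.tendsto_apprSeq hs) t
      have h2 : Tendsto (fun n => v n t) atTop
          (𝓝 (((s.indicator (fun _ => (1 : NNReal)) t : NNReal) : ℝ) : ℂ)) :=
        (Complex.continuous_ofReal.tendsto _).comp ((NNReal.continuous_coe.tendsto _).comp h1)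
      convert h2.mul_const (F t) using 2
      by_cases ht : t ∈ s <;> simp [ht]
  simp only [hzero] at hlim
  exact tendsto_nhds_unique hlim tendsto_const_nhds

theorem coeFn_multiplicationOperator (φ : LinftyTorus) (f : L2Torus) :
    multiplicationOperator φ f =ᵐ[torusMeasure] fun t => φ t * f t :=
  ContinuousLinearMap.coeFn_holder (r := 2) (ContinuousLinearMap.mul ℂ ℂ) φ f

theorem multiplicationOperator_comm (φ ψ : LinftyTorus) (f : L2Torus) :
    multiplicationOperator φ (multiplicationOperator ψ f) =
      multiplicationOperator ψ (multiplicationOperator φ f) := by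
  refine Lp.ext ?_
  filter_upwards [coeFn_multiplicationOperator φ (multiplicationOperator ψ f),
    coeFn_multiplicationOperator ψ (multiplicationOperator φ f),
    coeFn_multiplicationOperator φ f, coeFn_multiplicationOperator ψ f] with t h1 h2 h3 h4
  rw [h1, h2, h3, h4]
  ring

/-- Multiplication by the monomial `e^{inθ}` on `L²(𝕋)`. -/
noncomputable abbrev shift (n : ℤ) : L2Torus →L[ℂ] L2Torus := multiplicationOperator (fourierLp ∞ n)

theorem coeFn_shift (n : ℤ) (f : L2Torus) :
    shift n f =ᵐ[torusMeasure] fun t => fourier n t * f t := by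
  filter_upwards [coeFn_multiplicationOperator (fourierLp ∞ n) f,
    coeFn_fourierLp (T := 2 * π) ∞ n] with t h1 h2
  rw [h1, h2]

theorem shift_shift (m n : ℤ) (f : L2Torus) : shift m (shift n f) = shift (m + n) f := by
  refine Lp.ext ?_
  filter_upwards [coeFn_shift m (shift n f), coeFn_shift n f, coeFn_shift (m + n) f]
    with t h1 h2 h3
  rw [h1, h2, h3, fourier_add, mul_assoc]

theorem fourierCoeff_shift (m n : ℤ) (f : L2Torus) :
    fourierCoeff (shift m f) n = fourierCoeff f (n - m) := by
  refine integral_congr_ae ?_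
  filter_upwards [coeFn_shift m f] with t h1
  rw [h1, smul_eq_mul, smul_eq_mul, ← mul_assoc, ← fourier_add]
  congr 3
  ring

theorem shift_mem_hardySpace {m : ℤ} (hm : 0 ≤ m) {f : L2Torus} (hf : f ∈ hardySpace) :
    shift m f ∈ hardySpace := fun n hn => by
  rw [fourierCoeff_shift]
  exact hf _ (by lia)

/-- A nonzero function in the Hardy space has a first nonzero Fourier coefficient. -/
theorem exists_first_fourierCoeff {f : L2Torus} (hf : f ∈ hardySpace) (h0 : f ≠ 0) :
    ∃ k : ℤ, fourierCoeff f k ≠ 0 ∧ ∀ n < k, fourierCoeff f n = 0 := by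
  have hex : ∃ k : ℕ, fourierCoeff f k ≠ 0 := by
    by_contra! hall
    refine h0 (fourierBasis.repr.map_eq_zero_iff.1 ?_)
    ext n
    rw [fourierBasis_repr]
    rcases lt_or_ge n 0 with hn | hn
    · exact hf n hn
    · lift n to ℕ using hn
      exact hall n
  classical
  refine ⟨Nat.find hex, Nat.find_spec hex, fun n hn => ?_⟩
  rcases lt_or_ge n 0 with hn0 | hn0
  · exact hf n hn0
  · lift n to ℕ using hn0
    exact not_not.1 (Nat.find_min hex (by exact_mod_cast hn))

/-- If `g` is orthogonal to all `e^{inθ} g` with `n ≥ 1` then `|g|` is constant; so if `g ≠ 0`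
it vanishes almost nowhere. -/
theorem ae_ne_zero_of_inner_shift_eq_zero {g : L2Torus} (hg : g ≠ 0)
    (h : ∀ n : ℤ, 0 < n → inner ℂ g (shift n g) = 0) : ∀ᵐ t ∂torusMeasure, g t ≠ 0 := by
  have hint : Integrable (fun t => conj (g t) * g t) torusMeasure := by
    simpa only [RCLike.inner_apply'] using L2.integrable_inner (𝕜 := ℂ) g g
  have hcoeff : ∀ n : ℤ, inner ℂ g (shift n g) =
      ∫ t, fourier n t * (conj (g t) * g t) ∂torusMeasure := fun n => by
    rw [L2.inner_def]
    refine integral_congr_ae ?_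
    filter_upwards [coeFn_shift n g] with t ht
    rw [RCLike.inner_apply', ht]
    ring
  have hne : ∀ n : ℤ, n ≠ 0 → ∫ t, fourier n t * (conj (g t) * g t) ∂torusMeasure = 0 := by
    intro n hn
    rcases lt_or_gt_of_ne hn with hn | hn
    -- Since `|g|²` is real, its coefficients at `n` and `-n` are conjugate.
    · have h1 := h (-n) (by lia)
      rw [hcoeff] at h1
      have h2 := congrArg conj h1
      rw [← integral_conj, map_zero] at h2
      rw [← h2]
      refine integral_congr_ae (ae_of_all _ fun t => ?_)
      simp only [fourier_neg, map_mul, Complex.conj_conj]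
      ring
    · rw [← hcoeff, h n hn]
  set c : ℂ := ∫ t, conj (g t) * g t ∂torusMeasure with hc
  have hc0 : c ≠ 0 := by
    have : c = inner ℂ g g := by
      rw [L2.inner_def]
      simp only [RCLike.inner_apply', hc]
    rw [this]
    exact inner_self_ne_zero.2 hg
  have hzero := ae_eq_zero_of_fourierCoeff_eq_zero (F := fun t => conj (g t) * g t - c)
    (hint.sub (integrable_const c)) fun n => by
      have h1 : fourierCoeff (fun t : Torus => conj (g t) * g t - c) n =
          (∫ t, fourier (-n) t * (conj (g t) * g t) ∂torusMeasure) -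
            (∫ t : Torus, fourier (-n) t ∂torusMeasure) * c := by
        simp only [fourierCoeff, smul_eq_mul, mul_sub]
        rw [integral_sub (by simpa using hint.fourier_smul (-n))
          (by simpa using (integrable_const c).fourier_smul (-n)), integral_mul_const]
      have h2 : ∫ t : Torus, fourier (-n) t ∂torusMeasure = fourierCoeff (fourier (T := 2 * π) 0) n := by
        simp [fourierCoeff]
      rw [h1, h2, fourierCoeff_fourier]
      by_cases hn : n = 0
      · simp [hn, hc]
      · rw [hne _ (neg_ne_zero.2 hn)]
        simp [hn]
  filter_upwards [hzero] with t ht h0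
  apply hc0
  simpa [h0] using ht

/-- **F. and M. Riesz**: a nonzero function in the Hardy space vanishes almost nowhere. -/
theorem ae_ne_zero_of_mem_hardySpace {f : L2Torus} (hf : f ∈ hardySpace) (h0 : f ≠ 0) :
    ∀ᵐ t ∂torusMeasure, f t ≠ 0 := by
  obtain ⟨k, hk, hlt⟩ := exists_first_fourierCoeff hf h0
  -- Wandering vector argument: shifts by `n ≥ 1` map both `f` and `K` into `K`, so the component `f
  -- - p` of `f` orthogonal to `K` is orthogonal to its own shifts.
  set K : Submodule ℂ L2Torus :=
    (Submodule.span ℂ (range fun n : ℕ => shift (n + 1) f)).topologicalClosure with hK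
  have hKmin : ∀ S : Submodule ℂ L2Torus, IsClosed (S : Set L2Torus) →
      (∀ n : ℕ, shift (n + 1) f ∈ S) → K ≤ S := fun S hS h =>
    Submodule.topologicalClosure_minimal _
      (Submodule.span_le.2 (by rintro _ ⟨n, rfl⟩; exact h n)) hS
  have hKclosed : IsClosed (K : Set L2Torus) := Submodule.isClosed_topologicalClosure _
  have hshiftf : ∀ n : ℤ, 0 < n → shift n f ∈ K := fun n hn =>
    Submodule.le_topologicalClosure _ (Submodule.subset_span ⟨(n - 1).toNat, by
      simp only
      congr 2
      lia⟩)
  have hshift : ∀ n : ℤ, 0 < n → ∀ u ∈ K, shift n u ∈ K := fun n hn =>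
    hKmin (K.comap (shift n).toLinearMap) (hKclosed.preimage (shift n).continuous) fun m => by
      rw [Submodule.mem_comap]
      change shift n (shift (m + 1) f) ∈ K
      rw [shift_shift]
      exact hshiftf _ (by lia)
  have hKcoeff : ∀ u ∈ K, inner ℂ (fourierBasis k) u = (0 : ℂ) := fun u hu => by
    have := hKmin (LinearMap.ker (innerSL ℂ (fourierBasis (T := 2 * π) k)).toLinearMap)
      (innerSL ℂ (fourierBasis (T := 2 * π) k)).isClosed_ker (fun n => by
        rw [LinearMap.mem_ker]
        change inner ℂ (fourierBasis k) (shift (n + 1) f) = (0 : ℂ)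
        rw [← HilbertBasis.repr_apply_apply, fourierBasis_repr, fourierCoeff_shift]
        exact hlt _ (by lia)) hu
    exact this
  have : CompleteSpace K := hKclosed.completeSpace_coe
  set p : L2Torus := K.starProjection f with hp
  have hpK : p ∈ K := K.starProjection_apply_mem f
  -- The `k`-th coefficient vanishes on `K` but not at `f`, so `f ∉ K`.
  have hg0 : f - p ≠ 0 := fun h => by
    rw [← fourierBasis_repr, HilbertBasis.repr_apply_apply, sub_eq_zero.1 h] at hk
    exact hk (hKcoeff p hpK)
  have hgne := ae_ne_zero_of_inner_shift_eq_zero hg0 fun n hn =>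
    Submodule.inner_left_of_mem_orthogonal
      (by rw [map_sub]; exact K.sub_mem (hshiftf n hn) (hshift n hn p hpK))
      (K.sub_starProjection_mem_orthogonal f)
  have hE : MeasurableSet {t | f t = 0} :=
    (Lp.stronglyMeasurable f).measurable (measurableSet_singleton 0)
  -- Multiplication by `χ` kills `f` and commutes with shifts, so it kills `K` and `f - p`. As `f -
  -- p` is nonzero a.e., the zero set of `f` is null.
  let χ : LinftyTorus := indicatorConstLp ∞ hE (measure_ne_top torusMeasure _) (1 : ℂ)
  have hχ : χ =ᵐ[torusMeasure] {t | f t = 0}.indicator fun _ => (1 : ℂ) := indicatorConstLp_coeFn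
  have hχf : multiplicationOperator χ f = 0 := by
    refine Lp.ext ?_
    filter_upwards [coeFn_multiplicationOperator χ f, hχ, Lp.coeFn_zero ℂ 2 torusMeasure]
      with t h1 h2 h3
    rw [h1, h2, h3]
    by_cases ht : f t = 0 <;> simp [ht]
  have hχp : multiplicationOperator χ p = 0 :=
    hKmin (LinearMap.ker (multiplicationOperator χ).toLinearMap)
      (multiplicationOperator χ).isClosed_ker (fun n => by
        rw [LinearMap.mem_ker]
        change multiplicationOperator χ (shift (n + 1) f) = 0
        rw [multiplicationOperator_comm, hχf, map_zero]) hpK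
  have hχg : multiplicationOperator χ (f - p) = 0 := by rw [map_sub, hχf, hχp, sub_zero]
  have hco := coeFn_multiplicationOperator χ (f - p)
  rw [hχg] at hco
  filter_upwards [hgne, hco, hχ, Lp.coeFn_zero ℂ 2 torusMeasure] with t h1 h2 h3 h4 h5
  rw [h4, h3, indicator_of_mem (by exact h5), one_mul] at h2
  exact h1 h2.symm

end Toeplitz

open Toeplitz in
theorem mainTheorem10 (φ : LinftyTorus) (hφ : φ ≠ 0) :
    LinearMap.ker (toeplitzOperator φ : hardySpace →ₗ[ℂ] hardySpace) = ⊥ ∨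
      LinearMap.ker (ContinuousLinearMap.adjoint (toeplitzOperator φ) :
        hardySpace →ₗ[ℂ] hardySpace) = ⊥ := by
  by_contra! hcon
  obtain ⟨f, hf, hf0⟩ := Submodule.exists_mem_ne_zero_of_ne_bot hcon.1
  obtain ⟨g, hg, hg0⟩ := Submodule.exists_mem_ne_zero_of_ne_bot hcon.2
  have hTf : toeplitzOperator φ f = 0 := hf
  have hTg : ContinuousLinearMap.adjoint (toeplitzOperator φ) g = 0 := hg
  have hinner : ∀ u v : hardySpace, inner ℂ u (toeplitzOperator φ v) =
      inner ℂ (u : L2Torus) (multiplicationOperator φ v) := fun u v =>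
    hardySpace.inner_orthogonalProjectionOnto_eq_of_mem_left u _
  have hint : Integrable (fun t => conj ((g : L2Torus) t) * (multiplicationOperator φ f) t)
      torusMeasure := by
    simpa only [RCLike.inner_apply'] using
      L2.integrable_inner (𝕜 := ℂ) (g : L2Torus) (multiplicationOperator φ f)
  have hzero := ae_eq_zero_of_fourierCoeff_eq_zero hint fun n => by
    rcases le_total 0 n with hn | hn
    · have h1 := hinner ⟨shift n g, shift_mem_hardySpace hn g.2⟩ f
      rw [hTf, inner_zero_right, L2.inner_def] at h1
      rw [h1]
      refine integral_congr_ae ?_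
      filter_upwards [coeFn_shift n g] with t h2
      rw [RCLike.inner_apply', h2, fourier_neg, map_mul, smul_eq_mul, mul_assoc]
    -- For `n ≤ 0` the factor `e^{-inθ}` is absorbed by `f`, which stays in `H²`.
    · have h1 := hinner g ⟨shift (-n) f, shift_mem_hardySpace (by lia) f.2⟩
      rw [← ContinuousLinearMap.adjoint_inner_left, hTg, inner_zero_left, L2.inner_def] at h1
      rw [h1]
      refine integral_congr_ae ?_
      filter_upwards [coeFn_multiplicationOperator φ (shift (-n) f), coeFn_shift (-n) f,
        coeFn_multiplicationOperator φ f] with t h2 h3 h4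
      rw [RCLike.inner_apply', h2, h3, h4, smul_eq_mul]
      ring
  refine hφ (Lp.ext ?_)
  filter_upwards [hzero, coeFn_multiplicationOperator φ f, Lp.coeFn_zero ℂ ∞ torusMeasure,
    ae_ne_zero_of_mem_hardySpace f.2 (by simpa using hf0),
    ae_ne_zero_of_mem_hardySpace g.2 (by simpa using hg0)] with t h1 h2 h3 h4 h5
  rw [h3]
  simpa [h2, h4, h5] using h1
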